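/- Let $n\ge 2$ and let $\mathcal M$ be the manifold of positive definite $n\times n$ complex matrices, an open subset of the real vector space $\mathcal M_h$ of Hermitian matrices, all tangent spaces being identified with $\mathcal M_h$. For $\alpha\in\mathbb R$ put $f_\alpha(x)=\frac{2}{1-\alpha}x^{(1-\alpha)/2}$ if $\alpha\ne1$ and $f_1(x)=\log x$, let $L_\alpha[\rho]$ be the (invertible) Fréchet derivative of $\rho\mapsto f_\alpha(\rho)$ at $\rho\in\mathcal M$, and let the $\alpha$-connection $\nabla^{(\alpha)}$ on $\mathcal M$ be defined by $L_\alpha[\rho]\big((\nabla^{(\alpha)}_{\mathcal X}\mathcal Y)(\rho)\big)=(\mathcal X\mathcal Y f_\alpha)(\rho)$ for smooth vector fields $\mathcal X,\mathcal Y$. The mixture and exponential connections are $\nabla^{(m)}=\nabla^{(-1)}$ and $\nabla^{(e)}=\nabla^{(1)}$. The BKM metric is $\lambda_\rho(X,Y)=\frac{\partial^2}{\partial s\,\partial t}\operatorname{Tr}(\rho+sX)\log(\rho+tY)\big|_{s=t=0}$. A connection is flat if it is torsion-free and its Riemannian curvature tensor vanishes on $\mathcal M$; connections $\nabla,\nabla^*$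 are dual with respect to $\lambda$ if $\mathcal X\lambda(\mathcal Y,\mathcal Z)=\lambda(\nabla_{\mathcal X}\mathcal Y,\mathcal Z)+\lambda(\mathcal Y,\nabla^*_{\mathcal X}\mathcal Z)$ for all smooth vector fields. (1) For every $p\in[0,1]$ the connection $\nabla^{(p),\mathrm{mix}}=p\nabla^{(m)}+(1-p)\nabla^{(e)}$ is torsion-free, it is dual to $\nabla^{(1-p),\mathrm{mix}}$ with respect to the BKM metric, and it is flat if and only if $p=0$ or $p=1$. (2) For every $\alpha\in(-1,1)$ the connection $\frac{1+\alpha}{2}\nabla^{(e)}+\frac{1-\alpha}{2}\nabla^{(m)}$ is not flat, and it is different from $\nabla^{(\beta)}$ for every $\beta\in\mathbb R$. -/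

import Mathlib

open scoped ContDiff ComplexOrder Matrix.Norms.L2Operator

noncomputable section

namespace QuantumInfoGeom

/-- The real vector space of Hermitian `n × n` complex matrices (normed by the operator norm; all
norms on it are equivalent). -/
abbrev Herm (n : ℕ) : Type := selfAdjoint (Matrix (Fin n) (Fin n) ℂ)

/-- The manifold of positive definite matrices, an open subset of `Herm n`. Its tangent spaces are
identified with `Herm n`, hence vector fields are represented by functions `Herm n → Herm n`, of
which only the values on `posDef n` matter. -/
def posDef (n : ℕ) : Set (Herm n) := {ρ | (ρ : Matrix (Fin n) (Fin n) ℂ).PosDef}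

/-- `X` is (represents) a smooth vector field on the manifold of positive definite matrices. -/
def IsSmoothField {n : ℕ} (X : Herm n → Herm n) : Prop := ContDiffOn ℝ ∞ X (posDef n)

/-- Affine connections, written in the argument order of Mathlib's `CovariantDerivative`:
`D Y ρ (X ρ)` is the value at `ρ` of `∇_X Y`. -/
abbrev Connection (n : ℕ) : Type := (Herm n → Herm n) → Herm n → Herm n →L[ℝ] Herm n

/-- The vector field `∇_X Y`. -/
def Connection.apply {n : ℕ} (D : Connection n) (X Y : Herm n → Herm n) : Herm n → Herm n :=
  fun ρ => D Y ρ (X ρ)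

/-- Two connections on the manifold of positive definite matrices coincide. -/
def Connection.SameOn {n : ℕ} (D D' : Connection n) : Prop :=
  ∀ X Y : Herm n → Herm n, IsSmoothField X → IsSmoothField Y →
    ∀ ρ ∈ posDef n, D.apply X Y ρ = D'.apply X Y ρ

/-- `∇_X Y - ∇_Y X = [X, Y]` for all smooth vector fields. -/
def Connection.IsTorsionFree {n : ℕ} (D : Connection n) : Prop :=
  ∀ X Y : Herm n → Herm n, IsSmoothField X → IsSmoothField Y → ∀ ρ ∈ posDef n,
    D.apply X Y ρ - D.apply Y X ρ = VectorField.lieBracket ℝ X Y ρ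

/-- The Riemannian curvature `R(X, Y) Z = ∇_X ∇_Y Z - ∇_Y ∇_X Z - ∇_[X, Y] Z`. -/
def Connection.curvature {n : ℕ} (D : Connection n) (X Y Z : Herm n → Herm n) :
    Herm n → Herm n :=
  D.apply X (D.apply Y Z) - D.apply Y (D.apply X Z) - D.apply (VectorField.lieBracket ℝ X Y) Z

/-- The connection is flat: torsion-free with vanishing Riemannian curvature. -/
def Connection.IsFlat {n : ℕ} (D : Connection n) : Prop :=
  D.IsTorsionFree ∧
    ∀ X Y Z : Herm n → Herm n, IsSmoothField X → IsSmoothField Y → IsSmoothField Z →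
      ∀ ρ ∈ posDef n, D.curvature X Y Z ρ = 0

/-- `D` and `D'` are dual with respect to the metric `g`:
`X g(Y, Z) = g(∇_X Y, Z) + g(Y, ∇'_X Z)`. -/
def Connection.AreDual {n : ℕ} (g : Herm n → Herm n → Herm n → ℝ) (D D' : Connection n) : Prop :=
  ∀ X Y Z : Herm n → Herm n, IsSmoothField X → IsSmoothField Y → IsSmoothField Z →
    ∀ ρ ∈ posDef n, fderiv ℝ (fun σ => g σ (Y σ) (Z σ)) ρ (X ρ) =
      g ρ (D.apply X Y ρ) (Z ρ) + g ρ (Y ρ) (D'.apply X Z ρ)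

/-- The functions `f_α`. -/
def alphaFun (α : ℝ) (x : ℝ) : ℝ :=
  if α = 1 then Real.log x else 2 / (1 - α) * x ^ ((1 - α) / 2)

/-- The `α`-embedding `ρ ↦ f_α(ρ)`, by functional calculus. -/
def alphaEmbedding {n : ℕ} (α : ℝ) (ρ : Herm n) : Herm n :=
  ⟨cfc (alphaFun α) (ρ : Matrix (Fin n) (Fin n) ℂ), cfc_predicate _ _⟩

/-- `L_α[ρ]`, the derivative of the `α`-embedding, taking a tangent vector at `ρ` to its
`α`-representation. -/
def alphaRep {n : ℕ} (α : ℝ) (ρ : Herm n) : Herm n →L[ℝ] Herm n :=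
  fderiv ℝ (alphaEmbedding α) ρ

/-- The `α`-connection, given by `L_α((∇_X Y)(ρ)) = (X Y f_α)(ρ)`; here `Y f_α` is the function
`σ ↦ L_α[σ](Y σ)`, and `L_α[ρ]` is invertible at every positive definite `ρ`. -/
def alphaConnection {n : ℕ} (α : ℝ) : Connection n :=
  fun Y ρ => (alphaRep α ρ).inverse ∘L fderiv ℝ (fun σ => alphaRep α σ (Y σ)) ρ

/-- The mixture connection. -/
def mixtureConnection (n : ℕ) : Connection n := alphaConnection (-1)

/-- The exponential connection. -/
def exponentialConnection (n : ℕ) : Connection n := alphaConnection 1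

/-- The mixture `p ∇^(m) + (1 - p) ∇^(e)`. -/
def mixedConnection (n : ℕ) (p : ℝ) : Connection n :=
  p • mixtureConnection n + (1 - p) • exponentialConnection n

/-- The Kubo-Mori-Bogoljubov metric
`λ_ρ(X, Y) = ∂²/∂s∂t Tr (ρ + s X) log (ρ + t Y)` at `s = t = 0`. -/
def bkmMetric {n : ℕ} (ρ X Y : Herm n) : ℝ :=
  deriv (fun s : ℝ => deriv (fun t : ℝ =>
    (((ρ + s • X : Herm n) : Matrix (Fin n) (Fin n) ℂ) *
      cfc Real.log ((ρ + t • Y : Herm n) : Matrix (Fin n) (Fin n) ℂ)).trace.re) 0) 0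

end QuantumInfoGeom

end

/-! Each `alphaConnection α` is the pull-back of the trivial connection d along the chart
`alphaEmbedding α`, hence torsion-free and flat. For α = -1 the chart is the identity, so the
mixture connection is d itself, and the exponential connection is d + Γ with Γ = L⁻¹D²log. Thus the
mixture with weight p is d + (1-p)Γ. Flatness of d + Γ reads dΓ + Γ∧Γ = 0, so d + (1-p)Γ has
curvature -p(1-p) Γ∧Γ (`mixed_curvature_const`). At the identity matrix Γ(x,y) = -(xy+yx)/2
(`coe_christoffel_one`), and Jordan multiplications do not commute once n ≥ 2. The curvature is
therefore nonzero unless p is 0 or 1, and the mixture cannot equal any of the flat α-connections.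
For duality, the BKM metric is Tr X L₁(Y) (`bkmMetric_eq`). The product rule makes d dual to the
exponential connection; symmetry of the metric gives the reverse duality, and duality is preserved
by affine combinations. The logarithm and the powers are handled through exp: its derivative is
injective on Hermitian matrices and self-adjoint for the trace pairing. -/

noncomputable section

namespace QuantumInfoGeom

/-! ### Pull-backs of the trivial connection along a chart. -/

section Pullback

variable {V : Type*} [NormedAddCommGroup V] [NormedSpace ℝ V]

/-- The pull-back along `φ` of the trivial connection on `V`. -/
def pullbackConnection (φ : V → V) (Y : V → V) (ρ : V) : V →L[ℝ] V :=
  (fderiv ℝ φ ρ).inverse ∘L fderiv ℝ (fun σ => fderiv ℝ φ σ (Y σ)) ρ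

/-- `φ` is a smooth map with invertible derivative on the open set `U`. -/
structure IsChartOn (φ : V → V) (U : Set V) : Prop where
  isOpen : IsOpen U
  contDiffOn : ContDiffOn ℝ ∞ φ U
  isInvertible : ∀ ρ ∈ U, (fderiv ℝ φ ρ).IsInvertible

/-- The connection form `L⁻¹ D²φ` of the pull-back connection. -/
def christoffel (φ : V → V) (ρ X Y : V) : V :=
  (fderiv ℝ φ ρ).inverse (fderiv ℝ (fderiv ℝ φ) ρ X Y)

namespace IsChartOn

variable {φ : V → V} {U : Set V} (h : IsChartOn φ U)
include h

theorem mem_nhds {ρ : V} (hρ : ρ ∈ U) : U ∈ nhds ρ := h.isOpen.mem_nhds hρ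

theorem differentiableAt {F : Type*} [NormedAddCommGroup F] [NormedSpace ℝ F] {Y : V → F}
    (hY : ContDiffOn ℝ ∞ Y U) {ρ : V} (hρ : ρ ∈ U) : DifferentiableAt ℝ Y ρ :=
  (hY.contDiffAt (h.mem_nhds hρ)).differentiableAt (by simp)

theorem contDiffOn_fderiv {F : Type*} [NormedAddCommGroup F] [NormedSpace ℝ F] {Y : V → F}
    (hY : ContDiffOn ℝ ∞ Y U) : ContDiffOn ℝ ∞ (fderiv ℝ Y) U :=
  hY.fderiv_of_isOpen h.isOpen (by simp)

theorem contDiffOn_rep {Y : V → V} (hY : ContDiffOn ℝ ∞ Y U) :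
    ContDiffOn ℝ ∞ (fun σ => fderiv ℝ φ σ (Y σ)) U :=
  (h.contDiffOn_fderiv h.contDiffOn).clm_apply hY

theorem contDiffOn_inverse [CompleteSpace V] :
    ContDiffOn ℝ ∞ (fun σ => (fderiv ℝ φ σ).inverse) U := fun ρ hρ =>
  ((h.isInvertible ρ hρ).contDiffAt_map_inverse.comp ρ
    ((h.contDiffOn_fderiv h.contDiffOn).contDiffAt (h.mem_nhds hρ))).contDiffWithinAt

theorem contDiffOn_pullbackConnection [CompleteSpace V] {X Y : V → V}
    (hX : ContDiffOn ℝ ∞ X U) (hY : ContDiffOn ℝ ∞ Y U) :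
    ContDiffOn ℝ ∞ (fun σ => pullbackConnection φ Y σ (X σ)) U :=
  h.contDiffOn_inverse.clm_apply ((h.contDiffOn_fderiv (h.contDiffOn_rep hY)).clm_apply hX)

theorem apply_inverse {ρ : V} (hρ : ρ ∈ U) (v : V) :
    fderiv ℝ φ ρ ((fderiv ℝ φ ρ).inverse v) = v := by
  obtain ⟨e, he⟩ := h.isInvertible ρ hρ
  simp [← he]

theorem inverse_apply {ρ : V} (hρ : ρ ∈ U) (v : V) :
    (fderiv ℝ φ ρ).inverse (fderiv ℝ φ ρ v) = v := by
  obtain ⟨e, he⟩ := h.isInvertible ρ hρ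
  simp [← he]

theorem injective {ρ : V} (hρ : ρ ∈ U) : Function.Injective (fderiv ℝ φ ρ) :=
  Function.LeftInverse.injective (h.inverse_apply hρ)

theorem fderiv_apply {F G : Type*} [NormedAddCommGroup F] [NormedSpace ℝ F]
    [NormedAddCommGroup G] [NormedSpace ℝ G] {M : V → F →L[ℝ] G} {Y : V → F}
    (hM : ContDiffOn ℝ ∞ M U) (hY : ContDiffOn ℝ ∞ Y U) {ρ : V} (hρ : ρ ∈ U) (v : V) :
    fderiv ℝ (fun σ => M σ (Y σ)) ρ v = fderiv ℝ M ρ v (Y ρ) + M ρ (fderiv ℝ Y ρ v) := by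
  rw [fderiv_clm_apply (h.differentiableAt hM hρ) (h.differentiableAt hY hρ)]
  simp [add_comm]

theorem pullbackConnection_apply {Y : V → V} (hY : ContDiffOn ℝ ∞ Y U) {ρ : V} (hρ : ρ ∈ U)
    (v : V) : pullbackConnection φ Y ρ v = fderiv ℝ Y ρ v + christoffel φ ρ v (Y ρ) := by
  simp only [pullbackConnection, ContinuousLinearMap.comp_apply, christoffel]
  rw [h.fderiv_apply (h.contDiffOn_fderiv h.contDiffOn) hY hρ, map_add, h.inverse_apply hρ,
    add_comm]

theorem fderiv_fderiv_comm {W : V → V} (hW : ContDiffOn ℝ ∞ W U) {ρ : V} (hρ : ρ ∈ U) (v w : V) :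
    fderiv ℝ (fderiv ℝ W) ρ v w = fderiv ℝ (fderiv ℝ W) ρ w v :=
  ((hW.contDiffAt (h.mem_nhds hρ)).isSymmSndFDerivAt
    (by simpa using WithTop.coe_le_coe.2 (le_top : (2 : ℕ∞) ≤ ⊤))).eq v w

theorem christoffel_comm {ρ : V} (hρ : ρ ∈ U) (v w : V) :
    christoffel φ ρ v w = christoffel φ ρ w v := by
  rw [christoffel, h.fderiv_fderiv_comm h.contDiffOn hρ, christoffel]

/-- The connection form comes from a Hessian and is symmetric, so it cancels and the ordinary
derivatives leave the bracket. -/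
theorem torsion_eq_zero {X Y : V → V} (hX : ContDiffOn ℝ ∞ X U) (hY : ContDiffOn ℝ ∞ Y U)
    {ρ : V} (hρ : ρ ∈ U) :
    pullbackConnection φ Y ρ (X ρ) - pullbackConnection φ X ρ (Y ρ) =
      VectorField.lieBracket ℝ X Y ρ := by
  rw [h.pullbackConnection_apply hX hρ, h.pullbackConnection_apply hY hρ,
    h.christoffel_comm hρ (X ρ), VectorField.lieBracket]
  abel

theorem rep_pullbackConnection {Y : V → V} {ρ : V} (hρ : ρ ∈ U) (v : V) :
    fderiv ℝ φ ρ (pullbackConnection φ Y ρ v) = fderiv ℝ (fun σ => fderiv ℝ φ σ (Y σ)) ρ v :=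
  h.apply_inverse hρ _

/-- Read in the chart, covariant derivatives are ordinary ones, so this is the product rule for
D(rep Z) applied to Y. The Hessian term is symmetric, which is what kills the curvature. -/
theorem rep_pullbackConnection_twice {X Y Z : V → V} (hY : ContDiffOn ℝ ∞ Y U)
    (hZ : ContDiffOn ℝ ∞ Z U) {ρ : V} (hρ : ρ ∈ U) :
    fderiv ℝ φ ρ (pullbackConnection φ (fun σ => pullbackConnection φ Z σ (Y σ)) ρ (X ρ)) =
      fderiv ℝ (fderiv ℝ (fun σ => fderiv ℝ φ σ (Z σ))) ρ (X ρ) (Y ρ) +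
        fderiv ℝ (fun σ => fderiv ℝ φ σ (Z σ)) ρ (fderiv ℝ Y ρ (X ρ)) := by
  rw [h.rep_pullbackConnection hρ,
    ← h.fderiv_apply (h.contDiffOn_fderiv (h.contDiffOn_rep hZ)) hY hρ]
  congr 1
  apply Filter.EventuallyEq.fderiv_eq
  filter_upwards [h.mem_nhds hρ] with σ hσ
  exact h.rep_pullbackConnection hσ _

theorem curvature_eq_zero {X Y Z : V → V} (hX : ContDiffOn ℝ ∞ X U)
    (hY : ContDiffOn ℝ ∞ Y U) (hZ : ContDiffOn ℝ ∞ Z U) {ρ : V} (hρ : ρ ∈ U) :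
    pullbackConnection φ (fun σ => pullbackConnection φ Z σ (Y σ)) ρ (X ρ) -
      pullbackConnection φ (fun σ => pullbackConnection φ Z σ (X σ)) ρ (Y ρ) -
      pullbackConnection φ Z ρ (VectorField.lieBracket ℝ X Y ρ) = 0 := by
  apply h.injective hρ
  rw [map_sub, map_sub, map_zero, h.rep_pullbackConnection_twice hY hZ hρ,
    h.rep_pullbackConnection_twice hX hZ hρ, h.rep_pullbackConnection hρ,
    h.fderiv_fderiv_comm (h.contDiffOn_rep hZ) hρ (X ρ), VectorField.lieBracket, map_sub]
  abel

theorem contDiffOn_christoffel [CompleteSpace V] (Y Z : V) :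
    ContDiffOn ℝ ∞ (fun σ => christoffel φ σ Y Z) U :=
  h.contDiffOn_inverse.clm_apply (((h.contDiffOn_fderiv
    (h.contDiffOn_fderiv h.contDiffOn)).clm_apply (contDiffOn_const (c := Y))).clm_apply
      (contDiffOn_const (c := Z)))

/-- Zero curvature on constant fields is the structure equation dΓ + Γ∧Γ = 0; it serves to eliminate
the derivatives of Γ. -/
theorem fderiv_christoffel_sub [CompleteSpace V] {ρ : V} (hρ : ρ ∈ U) (X Y Z : V) :
    fderiv ℝ (fun σ => christoffel φ σ Y Z) ρ X - fderiv ℝ (fun σ => christoffel φ σ X Z) ρ Y =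
      christoffel φ ρ Y (christoffel φ ρ X Z) - christoffel φ ρ X (christoffel φ ρ Y Z) := by
  have key : ∀ A B : V,
      pullbackConnection φ (fun σ => pullbackConnection φ (fun _ => Z) σ A) ρ B =
        fderiv ℝ (fun σ => christoffel φ σ A Z) ρ B +
          christoffel φ ρ B (christoffel φ ρ A Z) := fun A B => by
    rw [← h.pullbackConnection_apply (h.contDiffOn_christoffel A Z) hρ]
    refine congrArg (fun T : V →L[ℝ] V => (fderiv ℝ φ ρ).inverse (T B)) (Filter.EventuallyEq.fderiv_eq ?_)
    filter_upwards [h.mem_nhds hρ] with σ hσ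
    rw [h.pullbackConnection_apply contDiffOn_const hσ]
    simp
  have hR := h.curvature_eq_zero (X := fun _ => X) (Y := fun _ => Y) (Z := fun _ => Z)
    contDiffOn_const contDiffOn_const contDiffOn_const hρ
  simp only [key, VectorField.lieBracket, fderiv_const_apply, zero_apply,
    sub_zero, map_zero] at hR
  rw [← sub_eq_zero, ← hR]
  abel

/-- The curvature, on constant fields, of a mixture of the trivial connection and a pull-back. -/
theorem mixed_curvature_const [CompleteSpace V] (p : ℝ) {D : (V → V) → V → V → V}
    (hD : ∀ Y ρ v, D Y ρ v = p • fderiv ℝ Y ρ v + (1 - p) • pullbackConnection φ Y ρ v)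
    {ρ : V} (hρ : ρ ∈ U) (X Y Z : V) :
    D (fun σ => D (fun _ => Z) σ Y) ρ X - D (fun σ => D (fun _ => Z) σ X) ρ Y =
      (p * (1 - p)) • (christoffel φ ρ Y (christoffel φ ρ X Z) -
        christoffel φ ρ X (christoffel φ ρ Y Z)) := by
  have hD' : ∀ {W : V → V}, ContDiffOn ℝ ∞ W U → ∀ σ ∈ U, ∀ v,
      D W σ v = fderiv ℝ W σ v + (1 - p) • christoffel φ σ v (W σ) := fun hW σ hσ v => by
    rw [hD, h.pullbackConnection_apply hW hσ]
    module
  have hlin : ∀ (c : ℝ) (A B : V), christoffel φ ρ A (c • B) = c • christoffel φ ρ A B := by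
    simp [christoffel]
  have key : ∀ A B : V, D (fun σ => D (fun _ => Z) σ A) ρ B =
      (1 - p) • fderiv ℝ (fun σ => christoffel φ σ A Z) ρ B +
        ((1 - p) * (1 - p)) • christoffel φ ρ B (christoffel φ ρ A Z) := fun A B => by
    have hs := h.contDiffOn_christoffel A Z
    have e : ∀ σ ∈ U, D (fun _ => Z) σ A = (1 - p) • christoffel φ σ A Z := fun σ hσ => by
      rw [hD' contDiffOn_const σ hσ]
      simp
    rw [hD' ((contDiffOn_const.smul hs).congr e) ρ hρ, e ρ hρ, hlin, smul_smul,
      Filter.EventuallyEq.fderiv_eq (Filter.eventually_of_mem (h.mem_nhds hρ) e),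
      fderiv_fun_const_smul (h.differentiableAt hs hρ)]
    rfl
  have := h.fderiv_christoffel_sub hρ X Y Z
  rw [sub_eq_iff_eq_add] at this
  -- dΓ carries the factor 1-p and the quadratic term (1-p)²; the structure equation leaves (1-p) -
  -- (1-p)² = p(1-p).
  rw [key, key, this]
  module

end IsChartOn

end Pullback

/-! ### The derivative of exp in a Banach algebra. -/

section BanachAlgebra

variable {A : Type*} [NormedRing A] [NormedAlgebra ℝ A]

/-- The derivative of `x ↦ x ^ k`. -/
def powDeriv (k : ℕ) (x : A) : A →L[ℝ] A :=
  ∑ i ∈ Finset.range k, MulOpposite.op (x ^ i) • x ^ (k.pred - i) • ContinuousLinearMap.id ℝ A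

theorem powDeriv_apply (k : ℕ) (x y : A) :
    powDeriv k x y = ∑ i ∈ Finset.range k, x ^ (k - 1 - i) * y * x ^ i := by
  simp [powDeriv]

/-- Cyclicity of τ exchanges the powers on the two sides of z, and reflecting the index i ↦ k-1-i
restores their order. -/
theorem trace_mul_powDeriv {F : Type*} [AddCommGroup F] [Module ℝ F] (τ : A →ₗ[ℝ] F)
    (hτ : ∀ x y, τ (x * y) = τ (y * x)) (k : ℕ) (x y z : A) :
    τ (y * powDeriv k x z) = τ (powDeriv k x y * z) := by
  rw [powDeriv_apply, powDeriv_apply, ← Finset.sum_range_reflect, Finset.mul_sum, Finset.sum_mul,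
    map_sum, map_sum]
  refine Finset.sum_congr rfl fun i hi => ?_
  have : k - 1 - (k - 1 - i) = i := by
    have := Finset.mem_range.1 hi
    omega
  rw [this, ← mul_assoc, hτ]
  simp only [mul_assoc]

theorem norm_powDeriv_le [NormOneClass A] (k : ℕ) {x : A} {r : ℝ} (hx : ‖x‖ ≤ r) :
    ‖powDeriv k x‖ ≤ k * r ^ (k - 1) := by
  have hr : 0 ≤ r := (norm_nonneg x).trans hx
  refine ContinuousLinearMap.opNorm_le_bound _ (by positivity) fun y => ?_
  rw [powDeriv_apply]
  have : ∀ i ∈ Finset.range k, ‖x ^ (k - 1 - i) * y * x ^ i‖ ≤ r ^ (k - 1) * ‖y‖ := by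
    intro i hi
    have hi : i + (k - 1 - i) = k - 1 := by
      have := Finset.mem_range.1 hi
      omega
    have hp : ∀ j : ℕ, ‖x ^ j‖ ≤ r ^ j := fun j =>
      (norm_pow_le x j).trans (pow_le_pow_left₀ (norm_nonneg x) hx j)
    calc ‖x ^ (k - 1 - i) * y * x ^ i‖ ≤ ‖x ^ (k - 1 - i)‖ * ‖y‖ * ‖x ^ i‖ := norm_mul₃_le
      _ ≤ r ^ (k - 1 - i) * ‖y‖ * r ^ i := by gcongr <;> exact hp _
      _ = r ^ (i + (k - 1 - i)) * ‖y‖ := by rw [pow_add]; ring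
      _ = r ^ (k - 1) * ‖y‖ := by rw [hi]
  refine (norm_sum_le_of_le _ this).trans (le_of_eq ?_)
  simp [mul_assoc]

theorem summable_deriv_pow_div_factorial (r : ℝ) :
    Summable fun k : ℕ => (k.factorial : ℝ)⁻¹ * (k * r ^ (k - 1)) := by
  -- The term k = 0 vanishes through its factor k; shifting by one gives the exponential series.
  refine (summable_nat_add_iff 1).1 ((Real.summable_pow_div_factorial r).congr fun k => ?_)
  have : (k.factorial : ℝ) ≠ 0 := by positivity
  have : (k : ℝ) + 1 ≠ 0 := by positivity
  rw [Nat.factorial_succ]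
  push_cast
  field_simp

theorem norm_powDeriv_div_factorial_le [NormOneClass A] (k : ℕ) {x : A} {r : ℝ} (hx : ‖x‖ ≤ r) :
    ‖(k.factorial : ℝ)⁻¹ • powDeriv k x‖ ≤ (k.factorial : ℝ)⁻¹ * (k * r ^ (k - 1)) := by
  rw [norm_smul, Real.norm_of_nonneg (by positivity)]
  exact mul_le_mul_of_nonneg_left (norm_powDeriv_le k hx) (by positivity)

variable [CompleteSpace A]

theorem hasFDerivAt_exp_tsum [NormOneClass A] (x : A) :
    HasFDerivAt NormedSpace.exp (∑' k : ℕ, (k.factorial : ℝ)⁻¹ • powDeriv k x) x := by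
  rw [NormedSpace.exp_eq_tsum ℝ]
  refine hasFDerivAt_tsum_of_isPreconnected (summable_deriv_pow_div_factorial (‖x‖ + 1))
    Metric.isOpen_ball (convex_ball (0 : A) (‖x‖ + 1)).isPreconnected
    (fun k y _ => (hasFDerivAt_pow' k).const_smul _)
    (fun k y hy => norm_powDeriv_div_factorial_le k (mem_ball_zero_iff.1 hy).le)
    (x₀ := x) ?_ (NormedSpace.expSeries_summable' (𝕂 := ℝ) x) ?_ <;> simp

theorem trace_mul_fderiv_exp [NormOneClass A] {F : Type*} [NormedAddCommGroup F] [NormedSpace ℝ F]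
    (τ : A →L[ℝ] F) (hτ : ∀ x y, τ (x * y) = τ (y * x)) (x y z : A) :
    τ (y * fderiv ℝ NormedSpace.exp x z) = τ (fderiv ℝ NormedSpace.exp x y * z) := by
  have hs : Summable fun k : ℕ => (k.factorial : ℝ)⁻¹ • powDeriv k x :=
    .of_norm_bounded (summable_deriv_pow_div_factorial ‖x‖)
      fun k => norm_powDeriv_div_factorial_le k le_rfl
  rw [(hasFDerivAt_exp_tsum x).fderiv]
  let φ : (A →L[ℝ] A) →L[ℝ] F :=
    τ ∘L ContinuousLinearMap.mul ℝ A y ∘L ContinuousLinearMap.apply ℝ A z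
  let ψ : (A →L[ℝ] A) →L[ℝ] F :=
    τ ∘L (ContinuousLinearMap.mul ℝ A).flip z ∘L ContinuousLinearMap.apply ℝ A y
  suffices φ (∑' k : ℕ, (k.factorial : ℝ)⁻¹ • powDeriv k x) =
      ψ (∑' k : ℕ, (k.factorial : ℝ)⁻¹ • powDeriv k x) from this
  rw [φ.map_tsum hs, ψ.map_tsum hs]
  refine tsum_congr fun k => ?_
  rw [map_smul, map_smul]
  exact congrArg _ (trace_mul_powDeriv (τ : A →ₗ[ℝ] F) hτ k x y z)

theorem contDiff_exp : ContDiff ℝ ∞ (NormedSpace.exp : A → A) :=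
  contDiff_iff_contDiffAt.2 fun x => (NormedSpace.exp_analytic (𝕂 := ℝ) x).contDiffAt

theorem hasFDerivAt_exp' (x : A) :
    HasFDerivAt NormedSpace.exp (fderiv ℝ (NormedSpace.exp : A → A) x) x :=
  (contDiff_exp.differentiable (by simp) x).hasFDerivAt

/-- Differentiating `x * exp x = exp x * x`. -/
theorem mul_fderiv_exp_sub (x y : A) :
    x * fderiv ℝ NormedSpace.exp x y - fderiv ℝ NormedSpace.exp x y * x =
      NormedSpace.exp x * y - y * NormedSpace.exp x := by
  have h1 := (hasFDerivAt_id (𝕜 := ℝ) x).mul' (hasFDerivAt_exp' x)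
  have h2 := (hasFDerivAt_exp' x).mul' (hasFDerivAt_id (𝕜 := ℝ) x)
  have e : (id * NormedSpace.exp : A → A) = NormedSpace.exp * id := by
    ext z
    exact ((Commute.refl z).exp_right).eq
  rw [e] at h1
  have := congrArg (fun T : A →L[ℝ] A => T y) (h1.unique h2)
  simp only [id, add_apply, smul_apply, ContinuousLinearMap.id_apply, smul_eq_mul,
    MulOpposite.smul_eq_mul_unop, MulOpposite.unop_op] at this
  rw [sub_eq_sub_iff_add_eq_add, this]

/-- On the line x + ty the exponential factors as exp x · exp(ty). -/
theorem fderiv_exp_of_commute {x y : A} (h : Commute x y) :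
    fderiv ℝ NormedSpace.exp x y = NormedSpace.exp x * y := by
  have h1 : HasDerivAt (fun t : ℝ => NormedSpace.exp (x + t • y))
      (fderiv ℝ NormedSpace.exp x y) 0 := by
    have hl : HasDerivAt (fun t : ℝ => x + t • y) y 0 := by
      simpa using ((hasDerivAt_id (0 : ℝ)).smul_const y).const_add x
    have hx : HasFDerivAt NormedSpace.exp (fderiv ℝ (NormedSpace.exp : A → A) x)
        (x + (0 : ℝ) • y) := by simpa using hasFDerivAt_exp' x
    exact hx.comp_hasDerivAt (0 : ℝ) hl
  have h2 : HasDerivAt (fun t : ℝ => NormedSpace.exp (x + t • y)) (NormedSpace.exp x * y) 0 := by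
    have e : (fun t : ℝ => NormedSpace.exp (x + t • y)) =
        fun t : ℝ => NormedSpace.exp x * NormedSpace.exp (t • y) := by
      ext t
      let := NormedAlgebra.restrictScalars ℚ ℝ A
      exact NormedSpace.exp_add_of_commute (h.smul_right t)
    rw [e]
    simpa using (hasDerivAt_exp_smul_const (𝕂 := ℝ) y 0).const_mul (NormedSpace.exp x)
  exact h1.unique h2

end BanachAlgebra

/-! ### exp and log on Hermitian matrices; the α-embeddings are charts. -/

section Hermitian

variable {n : ℕ}

instance : FiniteDimensional ℝ (Herm n) :=
  inferInstanceAs (FiniteDimensional ℝ (selfAdjoint.submodule ℝ (Matrix (Fin n) (Fin n) ℂ)))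

instance : CompleteSpace (Herm n) := FiniteDimensional.complete ℝ _

/-- The inclusion of the Hermitian matrices. -/
def hermVal : Herm n →L[ℝ] Matrix (Fin n) (Fin n) ℂ :=
  (selfAdjoint.submodule ℝ (Matrix (Fin n) (Fin n) ℂ)).subtypeL

/-- The Hermitian part of a matrix. -/
def hermPart : Matrix (Fin n) (Fin n) ℂ →L[ℝ] Herm n :=
  LinearMap.toContinuousLinearMap (selfAdjointPart ℝ)

@[simp]
theorem hermVal_apply (x : Herm n) : hermVal x = x := rfl

/-- The exponential of a Hermitian matrix. -/
def hermExp (b : Herm n) : Herm n :=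
  hermPart (NormedSpace.exp (b : Matrix (Fin n) (Fin n) ℂ))

@[simp]
theorem coe_hermExp (b : Herm n) :
    (hermExp b : Matrix (Fin n) (Fin n) ℂ) = NormedSpace.exp (b : Matrix (Fin n) (Fin n) ℂ) :=
  b.2.exp.coe_selfAdjointPart_apply ℝ

theorem contDiff_hermExp : ContDiff ℝ ∞ (hermExp (n := n)) :=
  hermPart.contDiff.comp (contDiff_exp.comp hermVal.contDiff)

theorem hasFDerivAt_hermExp (b : Herm n) :
    HasFDerivAt hermExp (fderiv ℝ (hermExp (n := n)) b) b :=
  (contDiff_hermExp.differentiable (by simp) b).hasFDerivAt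

theorem coe_fderiv_hermExp (b x : Herm n) :
    (fderiv ℝ hermExp b x : Matrix (Fin n) (Fin n) ℂ) =
      fderiv ℝ NormedSpace.exp (b : Matrix (Fin n) (Fin n) ℂ) x := by
  have h1 : HasFDerivAt (fun b : Herm n => NormedSpace.exp (b : Matrix (Fin n) (Fin n) ℂ))
      (hermVal ∘L fderiv ℝ hermExp b) b :=
    (hermVal.hasFDerivAt.comp b (hasFDerivAt_hermExp b)).congr_of_eventuallyEq
      (.of_forall fun c => (coe_hermExp c).symm)
  have h2 := (hasFDerivAt_exp' (hermVal b)).comp b hermVal.hasFDerivAt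
  exact congrArg (fun T : Herm n →L[ℝ] Matrix (Fin n) (Fin n) ℂ => T x) (h1.unique h2)

/-- By `mul_fderiv_exp_sub`, a kernel vector commutes with exp b, hence with b = log(exp b). On such
vectors the derivative is multiplication by the unit exp b. -/
theorem fderiv_hermExp_injective (b : Herm n) : Function.Injective (fderiv ℝ hermExp b) := by
  refine (injective_iff_map_eq_zero _).2 fun x hx => ?_
  have h0 : fderiv ℝ NormedSpace.exp (b : Matrix (Fin n) (Fin n) ℂ) x = 0 := by
    rw [← coe_fderiv_hermExp, hx]
    rfl
  have h1 := mul_fderiv_exp_sub (b : Matrix (Fin n) (Fin n) ℂ) x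
  rw [h0, mul_zero, zero_mul, sub_zero, eq_comm, sub_eq_zero] at h1
  have h2 : Commute (b : Matrix (Fin n) (Fin n) ℂ) x := by
    have h3 := Commute.cfc_real h1 Real.log
    have h4 : cfc Real.log (NormedSpace.exp (b : Matrix (Fin n) (Fin n) ℂ)) = b :=
      CFC.log_exp _ b.2
    rwa [h4] at h3
  rw [fderiv_exp_of_commute h2] at h0
  have h5 := ((Matrix.isUnit_exp (b : Matrix (Fin n) (Fin n) ℂ)).mul_right_eq_zero).1 h0
  exact Subtype.ext h5

theorem isInvertible_of_injective {T : Herm n →L[ℝ] Herm n} (hT : Function.Injective T) :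
    T.IsInvertible :=
  ⟨(LinearEquiv.ofInjectiveEndo (T : Herm n →ₗ[ℝ] Herm n) hT).toContinuousLinearEquiv, rfl⟩

theorem alphaFun_one : alphaFun 1 = Real.log := by
  ext x
  simp [alphaFun]

theorem coe_alphaEmbedding_one (ρ : Herm n) :
    (alphaEmbedding 1 ρ : Matrix (Fin n) (Fin n) ℂ) =
      cfc Real.log (ρ : Matrix (Fin n) (Fin n) ℂ) := by
  rw [← alphaFun_one]
  rfl

theorem alphaEmbedding_one_hermExp (b : Herm n) : alphaEmbedding 1 (hermExp b) = b := by
  refine Subtype.ext ?_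
  rw [coe_alphaEmbedding_one, coe_hermExp]
  exact CFC.log_exp _ b.2

open scoped MatrixOrder in
theorem hermExp_alphaEmbedding_one {ρ : Herm n} (hρ : ρ ∈ posDef n) :
    hermExp (alphaEmbedding 1 ρ) = ρ := by
  refine Subtype.ext ?_
  rw [coe_hermExp, coe_alphaEmbedding_one]
  exact CFC.exp_log _ (Matrix.PosDef.isStrictlyPositive hρ)

open scoped MatrixOrder in
theorem hermExp_mem_posDef (b : Herm n) : hermExp b ∈ posDef n := by
  change Matrix.PosDef (hermExp b : Matrix (Fin n) (Fin n) ℂ)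
  rw [← Matrix.isStrictlyPositive_iff_posDef, coe_hermExp]
  exact (Matrix.isUnit_exp _).isStrictlyPositive (IsSelfAdjoint.exp_nonneg b.2)

/-- The derivative of the exponential as a continuous linear equivalence. -/
theorem exists_equiv_fderiv_hermExp (b : Herm n) :
    ∃ e : Herm n ≃L[ℝ] Herm n, HasStrictFDerivAt hermExp (e : Herm n →L[ℝ] Herm n) b ∧
      HasFDerivAt hermExp (e : Herm n →L[ℝ] Herm n) b := by
  obtain ⟨e, he⟩ := isInvertible_of_injective (fderiv_hermExp_injective b)
  refine ⟨e, he ▸ contDiff_hermExp.contDiffAt.hasStrictFDerivAt (by simp),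
    he ▸ hasFDerivAt_hermExp b⟩

/-- The positive definite matrices are the image of `hermExp`, which is a local homeomorphism by the
inverse function theorem. -/
theorem isOpen_posDef : IsOpen (posDef n) := by
  refine isOpen_iff_mem_nhds.2 fun ρ hρ => ?_
  obtain ⟨e, he, -⟩ := exists_equiv_fderiv_hermExp (alphaEmbedding 1 ρ)
  rw [← hermExp_alphaEmbedding_one hρ, ← he.map_nhds_eq_of_equiv, Filter.mem_map]
  exact Filter.univ_mem' hermExp_mem_posDef

/-- The smooth local inverse of exp must agree with log near ρ, because log is a global left inverse
of exp. -/
theorem contDiffOn_alphaEmbedding_one : ContDiffOn ℝ ∞ (alphaEmbedding (n := n) 1) (posDef n) := by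
  intro ρ hρ
  obtain ⟨e, -, he⟩ := exists_equiv_fderiv_hermExp (alphaEmbedding 1 ρ)
  have hc := contDiff_hermExp.contDiffAt (x := alphaEmbedding 1 ρ)
  have h1 := hc.to_localInverse he (by simp)
  have h2 := (hc.hasStrictFDerivAt' he (by simp)).localInverse_unique
    (.of_forall alphaEmbedding_one_hermExp)
  rw [hermExp_alphaEmbedding_one hρ] at h1 h2
  exact (h1.congr_of_eventuallyEq h2).contDiffWithinAt

theorem hasFDerivAt_alphaEmbedding_one {ρ : Herm n} (hρ : ρ ∈ posDef n) :
    HasFDerivAt (alphaEmbedding 1) (alphaRep 1 ρ) ρ :=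
  ((contDiffOn_alphaEmbedding_one.contDiffAt (isOpen_posDef.mem_nhds hρ)).differentiableAt
    (by simp)).hasFDerivAt

theorem fderiv_hermExp_alphaRep_one {ρ : Herm n} (hρ : ρ ∈ posDef n) (x : Herm n) :
    fderiv ℝ hermExp (alphaEmbedding 1 ρ) (alphaRep 1 ρ x) = x := by
  have h1 := (hasFDerivAt_hermExp (alphaEmbedding 1 ρ)).comp ρ (hasFDerivAt_alphaEmbedding_one hρ)
  have h2 : HasFDerivAt (hermExp ∘ alphaEmbedding (n := n) 1) (ContinuousLinearMap.id ℝ _) ρ := by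
    refine (hasFDerivAt_id ρ).congr_of_eventuallyEq ?_
    filter_upwards [isOpen_posDef.mem_nhds hρ] with σ hσ
    exact hermExp_alphaEmbedding_one hσ
  exact congrArg (fun T : Herm n →L[ℝ] Herm n => T x) (h1.unique h2)

theorem alphaRep_one_injective {ρ : Herm n} (hρ : ρ ∈ posDef n) :
    Function.Injective (alphaRep 1 ρ) :=
  Function.LeftInverse.injective (fderiv_hermExp_alphaRep_one hρ)

theorem isChartOn_alphaEmbedding_one : IsChartOn (alphaEmbedding (n := n) 1) (posDef n) :=
  ⟨isOpen_posDef, contDiffOn_alphaEmbedding_one,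
    fun _ hρ => isInvertible_of_injective (alphaRep_one_injective hρ)⟩

/-- In logarithmic coordinates a power is a rescaled exponential, which reduces every β ≠ 1 to exp
and log. -/
theorem alphaEmbedding_hermExp {β : ℝ} (hβ : β ≠ 1) (b : Herm n) :
    alphaEmbedding β (hermExp b) = (2 / (1 - β)) • hermExp (((1 - β) / 2) • b) := by
  refine Subtype.ext ?_
  have h0 : IsSelfAdjoint (b : Matrix (Fin n) (Fin n) ℂ) := b.2
  have h1 : IsSelfAdjoint (((1 - β) / 2) • (b : Matrix (Fin n) (Fin n) ℂ)) :=
    (((1 - β) / 2) • b).2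
  change cfc (alphaFun β) (hermExp b : Matrix (Fin n) (Fin n) ℂ) =
    (2 / (1 - β)) • (hermExp (((1 - β) / 2) • b) : Matrix (Fin n) (Fin n) ℂ)
  rw [coe_hermExp, coe_hermExp, ← CFC.real_exp_eq_normedSpace_exp h0]
  change _ = (2 / (1 - β)) • NormedSpace.exp (((1 - β) / 2) • (b : Matrix (Fin n) (Fin n) ℂ))
  -- The real power may be discontinuous at 0, but the spectrum of exp b avoids 0.
  have hc : ContinuousOn (alphaFun β)
      (Real.exp '' spectrum ℝ (b : Matrix (Fin n) (Fin n) ℂ)) := by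
    rintro _ ⟨x, -, rfl⟩
    have : alphaFun β = fun x => 2 / (1 - β) * x ^ ((1 - β) / 2) := by
      ext x
      rw [alphaFun, if_neg hβ]
    rw [this]
    exact ((Real.continuousAt_rpow_const _ _ (.inl (Real.exp_ne_zero x))).const_mul
      _).continuousWithinAt
  rw [← CFC.real_exp_eq_normedSpace_exp h1, ← cfc_comp (alphaFun β) Real.exp _ h0 hc,
    ← cfc_comp_smul ((1 - β) / 2) Real.exp (b : Matrix (Fin n) (Fin n) ℂ),
    ← cfc_smul (2 / (1 - β)) (fun x => Real.exp (((1 - β) / 2) • x))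
      (b : Matrix (Fin n) (Fin n) ℂ) (by fun_prop)]
  refine congrArg (fun f => cfc f (b : Matrix (Fin n) (Fin n) ℂ)) (funext fun x => ?_)
  simp only [Function.comp_apply, alphaFun, if_neg hβ, smul_eq_mul]
  rw [mul_comm ((1 - β) / 2), Real.exp_mul]

theorem isChartOn_alphaEmbedding (β : ℝ) : IsChartOn (alphaEmbedding (n := n) β) (posDef n) := by
  rcases eq_or_ne β 1 with rfl | hβ
  · exact isChartOn_alphaEmbedding_one
  set s := (1 - β) / 2 with hs
  have hs0 : s ≠ 0 := div_ne_zero (sub_ne_zero.2 hβ.symm) two_ne_zero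
  have h2 : 2 / (1 - β) ≠ 0 := div_ne_zero two_ne_zero (sub_ne_zero.2 hβ.symm)
  have e : ∀ ρ ∈ posDef n, alphaEmbedding β ρ =
      (2 / (1 - β)) • hermExp (s • alphaEmbedding 1 ρ) := fun ρ hρ => by
    rw [← alphaEmbedding_hermExp hβ, hermExp_alphaEmbedding_one hρ]
  refine ⟨isOpen_posDef, ?_, fun ρ hρ => isInvertible_of_injective ?_⟩
  · exact ((contDiff_hermExp.comp_contDiffOn
      (contDiffOn_alphaEmbedding_one.const_smul s)).const_smul (2 / (1 - β))).congr e
  · have h := ((hasFDerivAt_hermExp (s • alphaEmbedding 1 ρ)).comp ρ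
      ((hasFDerivAt_alphaEmbedding_one hρ).const_smul s)).const_smul (2 / (1 - β))
    have h' := h.congr_of_eventuallyEq
      (Filter.eventually_of_mem (isOpen_posDef.mem_nhds hρ) e)
    rw [h'.fderiv]
    exact (smul_right_injective _ h2).comp ((fderiv_hermExp_injective _).comp
      ((smul_right_injective _ hs0).comp (alphaRep_one_injective hρ)))

theorem alphaEmbedding_neg_one : alphaEmbedding (n := n) (-1) = id := by
  ext1 ρ
  refine Subtype.ext ?_
  have h0 : IsSelfAdjoint (ρ : Matrix (Fin n) (Fin n) ℂ) := ρ.2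
  have h1 : alphaFun (-1) = id := by
    ext x
    norm_num [alphaFun]
  change cfc (alphaFun (-1)) (ρ : Matrix (Fin n) (Fin n) ℂ) = ρ
  rw [h1, cfc_id ℝ _ h0]

theorem mixtureConnection_apply (Y : Herm n → Herm n) (ρ v : Herm n) :
    mixtureConnection n Y ρ v = fderiv ℝ Y ρ v := by
  simp [mixtureConnection, alphaConnection, alphaRep, alphaEmbedding_neg_one]

end Hermitian

/-! ### The exponential connection form at the identity. -/

section SecondDerivative

theorem hasDerivAt_smul_apply {V W : Type*} [NormedAddCommGroup V] [NormedSpace ℝ V]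
    [NormedAddCommGroup W] [NormedSpace ℝ W] {f : V → V →L[ℝ] W} (hf : DifferentiableAt ℝ f 0)
    (x : V) : HasDerivAt (fun t : ℝ => f (t • x) x) (fderiv ℝ f 0 x x) 0 := by
  have hl : HasDerivAt (fun t : ℝ => t • x) x 0 := by
    simpa using (hasDerivAt_id (0 : ℝ)).smul_const x
  have hx : HasFDerivAt f (fderiv ℝ f 0) ((0 : ℝ) • x) := by
    rw [zero_smul]
    exact hf.hasFDerivAt
  have h0 : HasDerivAt (fun t : ℝ => f (t • x)) (fderiv ℝ f 0 x) 0 :=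
    hx.comp_hasDerivAt (0 : ℝ) hl
  exact (ContinuousLinearMap.apply ℝ W x).hasFDerivAt.comp_hasDerivAt (0 : ℝ) h0

variable {n : ℕ}

theorem alphaEmbedding_one_hermExp_zero : alphaEmbedding 1 (hermExp (0 : Herm n)) = 0 :=
  alphaEmbedding_one_hermExp 0

theorem fderiv_hermExp_zero (x : Herm n) : fderiv ℝ hermExp 0 x = x := by
  refine Subtype.ext ?_
  rw [coe_fderiv_hermExp, fderiv_exp_of_commute (Commute.zero_left _)]
  simp

theorem alphaRep_one_hermExp_zero (x : Herm n) : alphaRep 1 (hermExp 0) x = x := by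
  have := fderiv_hermExp_alphaRep_one (hermExp_mem_posDef 0) x
  rwa [alphaEmbedding_one_hermExp_zero, fderiv_hermExp_zero] at this

theorem contDiff_fderiv_hermExp : ContDiff ℝ ∞ (fderiv ℝ (hermExp (n := n))) :=
  contDiff_hermExp.fderiv_right (by simp)

/-- Differentiating Dexp(log ρ)(L y) = y in the direction x trades the second derivative of log for
that of exp. -/
theorem christoffel_alphaEmbedding_one {ρ : Herm n} (hρ : ρ ∈ posDef n) (x y : Herm n) :
    christoffel (alphaEmbedding 1) ρ x y =
      -fderiv ℝ (fderiv ℝ hermExp) (alphaEmbedding 1 ρ) (alphaRep 1 ρ x) (alphaRep 1 ρ y) := by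
  have h := isChartOn_alphaEmbedding_one (n := n)
  have hL : ContDiffOn ℝ ∞ (alphaRep (n := n) 1) (posDef n) := h.contDiffOn_fderiv h.contDiffOn
  have h1 := h.fderiv_apply (contDiff_fderiv_hermExp.comp_contDiffOn h.contDiffOn)
    (hL.clm_apply (contDiffOn_const (c := y))) hρ x
  have h2 : fderiv ℝ (fun σ => (fderiv ℝ hermExp ∘ alphaEmbedding 1) σ (alphaRep 1 σ y)) ρ x
      = 0 := by
    have : (fun σ => (fderiv ℝ hermExp ∘ alphaEmbedding 1) σ (alphaRep 1 σ y)) =ᶠ[nhds ρ]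
        fun _ => y := Filter.eventually_of_mem (h.mem_nhds hρ)
      fun σ hσ => fderiv_hermExp_alphaRep_one hσ y
    rw [this.fderiv_eq]
    simp
  have h3 : fderiv ℝ (fderiv ℝ hermExp ∘ alphaEmbedding 1) ρ x =
      fderiv ℝ (fderiv ℝ hermExp) (alphaEmbedding 1 ρ) (alphaRep 1 ρ x) := by
    rw [((contDiff_fderiv_hermExp.differentiable (by simp) _).hasFDerivAt.comp ρ
      (hasFDerivAt_alphaEmbedding_one hρ)).fderiv]
    rfl
  have h4 : fderiv ℝ (fun σ => alphaRep 1 σ y) ρ x =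
      fderiv ℝ (fderiv ℝ (alphaEmbedding 1)) ρ x y := by
    change _ = fderiv ℝ (alphaRep 1) ρ x y
    simpa using h.fderiv_apply hL (contDiffOn_const (c := y)) hρ x
  rw [h2, h3, h4] at h1
  have h5 := fderiv_hermExp_alphaRep_one hρ (christoffel (alphaEmbedding 1) ρ x y)
  rw [christoffel, alphaRep, h.apply_inverse hρ] at h5
  rw [eq_neg_iff_add_eq_zero, add_comm, christoffel, ← h5]
  exact h1.symm

/-- Along the line tx everything commutes, so Dexp(tx)x = exp(tx)x, whose derivative at 0 is x². The
mixed case follows by polarization. -/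
theorem fderiv_fderiv_hermExp_zero_self (x : Herm n) :
    (fderiv ℝ (fderiv ℝ hermExp) 0 x x : Matrix (Fin n) (Fin n) ℂ) = x * x := by
  have h1 : HasDerivAt (fun t : ℝ => hermVal (fderiv ℝ hermExp (t • x) x))
      (hermVal (fderiv ℝ (fderiv ℝ hermExp) 0 x x)) 0 := by
    exact hermVal.hasFDerivAt.comp_hasDerivAt (0 : ℝ)
      (hasDerivAt_smul_apply (contDiff_fderiv_hermExp.differentiable (by simp) 0) x)
  have h2 := (hasDerivAt_exp_smul_const (𝕂 := ℝ) (x : Matrix (Fin n) (Fin n) ℂ) 0).mul_const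
    (x : Matrix (Fin n) (Fin n) ℂ)
  have e : (fun t : ℝ => hermVal (fderiv ℝ hermExp (t • x) x)) =
      fun t : ℝ => NormedSpace.exp (t • (x : Matrix (Fin n) (Fin n) ℂ)) * x := by
    ext1 t
    rw [hermVal_apply, coe_fderiv_hermExp]
    exact fderiv_exp_of_commute ((Commute.refl (x : Matrix (Fin n) (Fin n) ℂ)).smul_left t)
  rw [e] at h1
  simpa using h1.unique h2

theorem coe_fderiv_fderiv_hermExp_zero (x y : Herm n) :
    (fderiv ℝ (fderiv ℝ hermExp) 0 x y : Matrix (Fin n) (Fin n) ℂ) =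
      (2⁻¹ : ℝ) • ((x : Matrix (Fin n) (Fin n) ℂ) * y + y * x) := by
  set B := fderiv ℝ (fderiv ℝ (hermExp (n := n))) 0 with hB
  have hs : B y x = B x y := (contDiff_hermExp.contDiffAt.isSymmSndFDerivAt
    (by simpa using WithTop.coe_le_coe.2 (le_top : (2 : ℕ∞) ≤ ⊤))).eq y x
  have h := fderiv_fderiv_hermExp_zero_self (x + y)
  rw [← hB] at h
  simp only [map_add, add_apply, hs, AddSubgroup.coe_add, add_mul, mul_add] at h
  rw [hB, fderiv_fderiv_hermExp_zero_self, fderiv_fderiv_hermExp_zero_self, ← hB] at h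
  rw [eq_inv_smul_iff₀ two_ne_zero, two_smul]
  rw [← sub_eq_zero] at h ⊢
  rw [← h]
  abel

theorem coe_christoffel_one (x y : Herm n) :
    ((christoffel (alphaEmbedding 1) (hermExp 0) x y : Herm n) : Matrix (Fin n) (Fin n) ℂ) =
      -((2⁻¹ : ℝ) • ((x : Matrix (Fin n) (Fin n) ℂ) * y + y * x)) := by
  rw [christoffel_alphaEmbedding_one (hermExp_mem_posDef 0), alphaEmbedding_one_hermExp_zero,
    alphaRep_one_hermExp_zero, alphaRep_one_hermExp_zero, ← coe_fderiv_fderiv_hermExp_zero]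
  rfl

/-- At the identity the connection forms of the exponential connection do not commute. -/
theorem exists_christoffel_not_comm (hn : 2 ≤ n) : ∃ x y z : Herm n,
    christoffel (alphaEmbedding 1) (hermExp 0) y
        (christoffel (alphaEmbedding 1) (hermExp 0) x z) -
      christoffel (alphaEmbedding 1) (hermExp 0) x
        (christoffel (alphaEmbedding 1) (hermExp 0) y z) ≠ 0 := by
  let i : Fin n := ⟨0, by omega⟩
  let j : Fin n := ⟨1, by omega⟩
  have hij : i ≠ j := by simp [i, j]
  let P : Herm n := ⟨Matrix.single i i 1, by
    rw [selfAdjoint.mem_iff, Matrix.star_eq_conjTranspose]; simp⟩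
  let S : Herm n := ⟨Matrix.single i j 1 + Matrix.single j i 1, by
    rw [selfAdjoint.mem_iff, Matrix.star_eq_conjTranspose]; simp [add_comm]⟩
  -- With P² = P and PS + SP = S, the two terms are S/2 and S/4, so the (i, j) entry of the
  -- difference is 1/4.
  refine ⟨P, S, P, fun h => ?_⟩
  have h' := congrArg (fun m : Herm n => (m : Matrix (Fin n) (Fin n) ℂ) i j) h
  simp only [AddSubgroup.coe_sub, coe_christoffel_one] at h'
  simp [P, S, hij, hij.symm, mul_add, add_mul, Matrix.single_mul_single_same] at h'

end SecondDerivative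

/-! ### Torsion, flatness and comparison of the mixed connections. -/

section Connections

variable {n : ℕ}

theorem alphaConnection_isTorsionFree (α : ℝ) : (alphaConnection (n := n) α).IsTorsionFree :=
  fun _ _ hX hY _ hρ => (isChartOn_alphaEmbedding α).torsion_eq_zero hX hY hρ

theorem alphaConnection_curvature (α : ℝ) {X Y Z : Herm n → Herm n} (hX : IsSmoothField X)
    (hY : IsSmoothField Y) (hZ : IsSmoothField Z) {ρ : Herm n} (hρ : ρ ∈ posDef n) :
    (alphaConnection α).curvature X Y Z ρ = 0 :=
  (isChartOn_alphaEmbedding α).curvature_eq_zero hX hY hZ hρ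

theorem alphaConnection_isFlat (α : ℝ) : (alphaConnection (n := n) α).IsFlat :=
  ⟨alphaConnection_isTorsionFree α, fun _ _ _ hX hY hZ _ hρ =>
    alphaConnection_curvature α hX hY hZ hρ⟩

theorem mixedConnection_apply (p : ℝ) (Y : Herm n → Herm n) (ρ v : Herm n) :
    mixedConnection n p Y ρ v =
      p • mixtureConnection n Y ρ v + (1 - p) • exponentialConnection n Y ρ v := rfl

theorem mixedConnection_isTorsionFree (p : ℝ) : (mixedConnection n p).IsTorsionFree := by
  intro X Y hX hY ρ hρ
  have h1 := alphaConnection_isTorsionFree (-1) X Y hX hY ρ hρ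
  have h2 := alphaConnection_isTorsionFree 1 X Y hX hY ρ hρ
  simp only [Connection.apply, mixedConnection_apply, mixtureConnection,
    exponentialConnection] at h1 h2 ⊢
  rw [sub_eq_iff_eq_add] at h1 h2
  rw [h1, h2]
  module

theorem mixedConnection_zero : mixedConnection n 0 = alphaConnection 1 := by
  refine funext fun Y => funext fun ρ => ContinuousLinearMap.ext fun v => ?_
  rw [mixedConnection_apply, zero_smul, zero_add, sub_zero, one_smul]
  rfl

theorem mixedConnection_one : mixedConnection n 1 = alphaConnection (-1) := by
  refine funext fun Y => funext fun ρ => ContinuousLinearMap.ext fun v => ?_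
  rw [mixedConnection_apply, sub_self, zero_smul, add_zero, one_smul]
  rfl

theorem mixedConnection_apply_isSmoothField (p : ℝ) {X Y : Herm n → Herm n}
    (hX : IsSmoothField X) (hY : IsSmoothField Y) :
    IsSmoothField ((mixedConnection n p).apply X Y) :=
  (((isChartOn_alphaEmbedding (-1)).contDiffOn_pullbackConnection hX hY).const_smul p).add
    (((isChartOn_alphaEmbedding 1).contDiffOn_pullbackConnection hX hY).const_smul (1 - p))

theorem exists_mixedConnection_curvature_ne_zero (hn : 2 ≤ n) {p : ℝ} (hp0 : p ≠ 0)
    (hp1 : p ≠ 1) : ∃ x y z : Herm n,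
      (mixedConnection n p).curvature (fun _ => x) (fun _ => y) (fun _ => z) (hermExp 0) ≠ 0 := by
  obtain ⟨x, y, z, h⟩ := exists_christoffel_not_comm hn
  refine ⟨x, y, z, ?_⟩
  have hc := isChartOn_alphaEmbedding_one.mixed_curvature_const p
    (D := fun Y ρ v => mixedConnection n p Y ρ v)
    (fun Y ρ v => by
      rw [mixedConnection_apply, mixtureConnection_apply]
      rfl) (hermExp_mem_posDef 0) x y z
  have e : (mixedConnection n p).curvature (fun _ => x) (fun _ => y) (fun _ => z) (hermExp 0) =
      (p * (1 - p)) • (christoffel (alphaEmbedding 1) (hermExp 0) y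
          (christoffel (alphaEmbedding 1) (hermExp 0) x z) -
        christoffel (alphaEmbedding 1) (hermExp 0) x
          (christoffel (alphaEmbedding 1) (hermExp 0) y z)) := by
    rw [← hc]
    simp only [Connection.curvature, Pi.sub_apply, Connection.apply, VectorField.lieBracket,
      fderiv_const_apply, zero_apply, sub_zero, map_zero]
    rfl
  rw [e]
  exact smul_ne_zero (mul_ne_zero hp0 (sub_ne_zero.2 hp1.symm)) h

theorem mixedConnection_not_isFlat (hn : 2 ≤ n) {p : ℝ} (hp0 : p ≠ 0) (hp1 : p ≠ 1) :
    ¬ (mixedConnection n p).IsFlat := fun h => by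
  obtain ⟨x, y, z, hne⟩ := exists_mixedConnection_curvature_ne_zero hn hp0 hp1
  exact hne (h.2 _ _ _ contDiffOn_const contDiffOn_const contDiffOn_const _
    (hermExp_mem_posDef 0))

/-- Only the germ of the field at ρ enters. This is needed because `SameOn` compares values on
`posDef n` alone, while the curvature differentiates them. -/
theorem alphaConnection_congr (α : ℝ) {Y Y' : Herm n → Herm n} {ρ : Herm n}
    (h : ∀ σ ∈ posDef n, Y σ = Y' σ) (hρ : ρ ∈ posDef n) :
    alphaConnection α Y ρ = alphaConnection α Y' ρ := by
  refine congrArg ((alphaRep α ρ).inverse ∘L ·) (Filter.EventuallyEq.fderiv_eq ?_)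
  filter_upwards [isOpen_posDef.mem_nhds hρ] with σ hσ
  rw [h σ hσ]

/-- Connections agreeing on smooth fields have equal curvature, and that of an α-connection
vanishes. -/
theorem mixedConnection_not_sameOn (hn : 2 ≤ n) {p : ℝ} (hp0 : p ≠ 0) (hp1 : p ≠ 1) (β : ℝ) :
    ¬ (mixedConnection n p).SameOn (alphaConnection β) := fun h => by
  obtain ⟨x, y, z, hne⟩ := exists_mixedConnection_curvature_ne_zero hn hp0 hp1
  have hc : ∀ w : Herm n, IsSmoothField fun _ => w := fun _ => contDiffOn_const
  have hρ := hermExp_mem_posDef (0 : Herm n)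
  have h2 : ∀ a b : Herm n,
      (mixedConnection n p).apply (fun _ => a)
          ((mixedConnection n p).apply (fun _ => b) fun _ => z) (hermExp 0) =
        (alphaConnection β).apply (fun _ => a)
          ((alphaConnection β).apply (fun _ => b) fun _ => z) (hermExp 0) := fun a b => by
    rw [h _ _ (hc a) (mixedConnection_apply_isSmoothField p (hc b) (hc z)) _ hρ]
    exact congrArg (fun T : Herm n →L[ℝ] Herm n => T a)
      (alphaConnection_congr β (h _ _ (hc b) (hc z)) hρ)
  have hl : IsSmoothField (VectorField.lieBracket ℝ (fun _ : Herm n => x) fun _ => y) := by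
    have : VectorField.lieBracket ℝ (fun _ : Herm n => x) (fun _ => y) = fun _ => 0 := by
      ext1 σ
      simp [VectorField.lieBracket]
    rw [this]
    exact hc 0
  refine hne (Eq.trans ?_ (alphaConnection_curvature β (hc x) (hc y) (hc z) hρ))
  simp only [Connection.curvature, Pi.sub_apply, h2]
  rw [h _ _ hl (hc z) _ hρ]

end Connections

/-! ### Derivatives of linear and bilinear expressions. -/

section Calculus

variable {V W F : Type*} [NormedAddCommGroup V] [NormedSpace ℝ V] [NormedAddCommGroup W]
  [NormedSpace ℝ W] [NormedAddCommGroup F] [NormedSpace ℝ F]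

theorem hasDerivAt_clm_line (ℓ : W →L[ℝ] F) {f : V → W} {f' : V →L[ℝ] W} {ρ : V}
    (hf : HasFDerivAt f f' ρ) (v : V) :
    HasDerivAt (fun t : ℝ => ℓ (f (ρ + t • v))) (ℓ (f' v)) 0 :=
  (ℓ.hasFDerivAt.comp ρ hf).hasLineDerivAt v

theorem fderiv_bilinear_apply (β : W →L[ℝ] W →L[ℝ] F) {Y Z : V → W} {ρ : V}
    (hY : DifferentiableAt ℝ Y ρ) (hZ : DifferentiableAt ℝ Z ρ) (v : V) :
    fderiv ℝ (fun σ => β (Y σ) (Z σ)) ρ v =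
      β (fderiv ℝ Y ρ v) (Z ρ) + β (Y ρ) (fderiv ℝ Z ρ v) := by
  have hβ : HasFDerivAt (fun σ => β (Y σ)) (β ∘L fderiv ℝ Y ρ) ρ :=
    β.hasFDerivAt.comp ρ hY.hasFDerivAt
  rw [fderiv_clm_apply hβ.differentiableAt hZ, hβ.fderiv]
  simp [add_comm]

end Calculus

/-! ### The BKM metric and duality. -/

section Metric

variable {n : ℕ}

/-- The real part of the trace. -/
def reTrace : Matrix (Fin n) (Fin n) ℂ →L[ℝ] ℝ :=
  LinearMap.toContinuousLinearMap (Complex.reLm ∘ₗ Matrix.traceLinearMap (Fin n) ℝ ℂ)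

theorem reTrace_apply (M : Matrix (Fin n) (Fin n) ℂ) : reTrace M = M.trace.re := rfl

theorem reTrace_mul_comm (M N : Matrix (Fin n) (Fin n) ℂ) : reTrace (M * N) = reTrace (N * M) := by
  rw [reTrace_apply, reTrace_apply, Matrix.trace_mul_comm]

/-- The trace pairing on Hermitian matrices. -/
def tracePairing : Herm n →L[ℝ] Herm n →L[ℝ] ℝ :=
  ContinuousLinearMap.compL ℝ (Herm n) (Matrix (Fin n) (Fin n) ℂ) ℝ reTrace ∘L
    (ContinuousLinearMap.mul ℝ (Matrix (Fin n) (Fin n) ℂ)).bilinearComp hermVal hermVal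

theorem tracePairing_apply (X Y : Herm n) :
    tracePairing X Y =
      reTrace ((X : Matrix (Fin n) (Fin n) ℂ) * (Y : Matrix (Fin n) (Fin n) ℂ)) := rfl

theorem tracePairing_comm (X Y : Herm n) : tracePairing X Y = tracePairing Y X :=
  reTrace_mul_comm _ _

/-- `NeZero n` makes the matrix algebra nontrivial, so that ‖1‖ = 1, as the termwise differentiation
of exp requires. -/
theorem tracePairing_fderiv_hermExp [NeZero n] (b X Y : Herm n) :
    tracePairing X (fderiv ℝ hermExp b Y) = tracePairing (fderiv ℝ hermExp b X) Y := by
  rw [tracePairing_apply, tracePairing_apply, coe_fderiv_hermExp, coe_fderiv_hermExp]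
  exact trace_mul_fderiv_exp reTrace reTrace_mul_comm _ _ _

theorem tracePairing_alphaRep_one [NeZero n] {ρ : Herm n} (hρ : ρ ∈ posDef n) (X Y : Herm n) :
    tracePairing X (alphaRep 1 ρ Y) = tracePairing (alphaRep 1 ρ X) Y := by
  conv_lhs => rw [← fderiv_hermExp_alphaRep_one hρ X]
  rw [← tracePairing_fderiv_hermExp, fderiv_hermExp_alphaRep_one hρ]

/-- The inner derivative is Tr (ρ + sX) L₁(Y), which is affine in s with slope Tr X L₁(Y). -/
theorem bkmMetric_eq {ρ : Herm n} (hρ : ρ ∈ posDef n) (X Y : Herm n) :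
    bkmMetric ρ X Y = tracePairing X (alphaRep 1 ρ Y) := by
  have h1 : ∀ Z : Herm n, HasDerivAt (fun t : ℝ => tracePairing Z (alphaEmbedding 1 (ρ + t • Y)))
      (tracePairing Z (alphaRep 1 ρ Y)) 0 := fun Z =>
    hasDerivAt_clm_line (tracePairing Z) (hasFDerivAt_alphaEmbedding_one hρ) Y
  have h2 : HasDerivAt (fun s : ℝ => tracePairing (ρ + s • X) (alphaRep 1 ρ Y))
      (tracePairing X (alphaRep 1 ρ Y)) 0 :=
    hasDerivAt_clm_line (tracePairing.flip (alphaRep 1 ρ Y)) (hasFDerivAt_id ρ) X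
  rw [← h2.deriv]
  refine congrArg (fun f : ℝ → ℝ => deriv f 0) (funext fun s => ?_)
  rw [← (h1 (ρ + s • X)).deriv]
  refine congrArg (fun f : ℝ → ℝ => deriv f 0) (funext fun t => ?_)
  rw [tracePairing_apply, coe_alphaEmbedding_one, reTrace_apply]

theorem bkmMetric_comm [NeZero n] {ρ : Herm n} (hρ : ρ ∈ posDef n) (X Y : Herm n) :
    bkmMetric ρ X Y = bkmMetric ρ Y X := by
  rw [bkmMetric_eq hρ, bkmMetric_eq hρ, tracePairing_alphaRep_one hρ, tracePairing_comm]

/-- Apply the product rule to Tr Y · L₁(Z): the derivative of L₁(Z) is, by definition, L₁ of the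
exponential covariant derivative of Z. -/
theorem mixture_exponential_areDual :
    Connection.AreDual bkmMetric (mixtureConnection n) (exponentialConnection n) := by
  intro X Y Z hX hY hZ ρ hρ
  have hc := isChartOn_alphaEmbedding_one (n := n)
  have e : (fun σ => bkmMetric σ (Y σ) (Z σ)) =ᶠ[nhds ρ]
      fun σ => tracePairing (Y σ) (alphaRep 1 σ (Z σ)) :=
    Filter.eventually_of_mem (hc.mem_nhds hρ) fun σ hσ => bkmMetric_eq hσ _ _
  have hW := hc.differentiableAt (hc.contDiffOn_rep hZ) hρ
  rw [e.fderiv_eq, bkmMetric_eq hρ, bkmMetric_eq hρ,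
    Connection.apply, mixtureConnection_apply, Connection.apply]
  refine (fderiv_bilinear_apply tracePairing (hc.differentiableAt hY hρ) hW (X ρ)).trans ?_
  exact congrArg _ (congrArg _ (hc.rep_pullbackConnection (Y := Z) hρ (X ρ)).symm)

theorem exponential_mixture_areDual [NeZero n] :
    Connection.AreDual bkmMetric (exponentialConnection n) (mixtureConnection n) := by
  intro X Y Z hX hY hZ ρ hρ
  have e : (fun σ => bkmMetric σ (Y σ) (Z σ)) =ᶠ[nhds ρ] fun σ => bkmMetric σ (Z σ) (Y σ) :=
    Filter.eventually_of_mem (isOpen_posDef.mem_nhds hρ) fun σ hσ => bkmMetric_comm hσ _ _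
  rw [e.fderiv_eq, mixture_exponential_areDual X Z Y hX hZ hY ρ hρ, add_comm,
    bkmMetric_comm hρ (Z ρ), bkmMetric_comm hρ _ (Y ρ)]

theorem mixedConnection_areDual [NeZero n] (p : ℝ) :
    Connection.AreDual bkmMetric (mixedConnection n p) (mixedConnection n (1 - p)) := by
  intro X Y Z hX hY hZ ρ hρ
  have h1 := mixture_exponential_areDual X Y Z hX hY hZ ρ hρ
  have h2 := exponential_mixture_areDual X Y Z hX hY hZ ρ hρ
  simp only [bkmMetric_eq hρ, Connection.apply, mixedConnection_apply, map_add, map_smul,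
    add_apply, smul_apply, smul_eq_mul] at h1 h2 ⊢
  -- The weights match because the second connection is (1-p) mixture + p exponential.
  linear_combination p * h1 + (1 - p) * h2

end Metric

end QuantumInfoGeom
end

theorem mainTheorem4 (n : ℕ) (hn : 2 ≤ n) :
    (∀ p ∈ Set.Icc (0 : ℝ) 1,
      (QuantumInfoGeom.mixedConnection n p).IsTorsionFree ∧
      QuantumInfoGeom.Connection.AreDual QuantumInfoGeom.bkmMetric
        (QuantumInfoGeom.mixedConnection n p) (QuantumInfoGeom.mixedConnection n (1 - p)) ∧
      ((QuantumInfoGeom.mixedConnection n p).IsFlat ↔ p = 0 ∨ p = 1)) ∧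
    (∀ α ∈ Set.Ioo (-1 : ℝ) 1,
      ¬ (((1 + α) / 2) • QuantumInfoGeom.exponentialConnection n +
          ((1 - α) / 2) • QuantumInfoGeom.mixtureConnection n :
            QuantumInfoGeom.Connection n).IsFlat ∧
      ∀ β : ℝ,
        ¬ (((1 + α) / 2) • QuantumInfoGeom.exponentialConnection n +
            ((1 - α) / 2) • QuantumInfoGeom.mixtureConnection n :
              QuantumInfoGeom.Connection n).SameOn (QuantumInfoGeom.alphaConnection β)) := by
  have : NeZero n := ⟨by omega⟩
  refine ⟨fun p _ => ⟨QuantumInfoGeom.mixedConnection_isTorsionFree p,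
    QuantumInfoGeom.mixedConnection_areDual p, fun h => ?_, ?_⟩, fun α hα => ?_⟩
  · by_contra! hp
    exact QuantumInfoGeom.mixedConnection_not_isFlat hn hp.1 hp.2 h
  · rintro (rfl | rfl)
    · rw [QuantumInfoGeom.mixedConnection_zero]
      exact QuantumInfoGeom.alphaConnection_isFlat 1
    · rw [QuantumInfoGeom.mixedConnection_one]
      exact QuantumInfoGeom.alphaConnection_isFlat (-1)
  -- This is the mixture with p = (1-α)/2, which lies strictly between 0 and 1.
  · have e : (((1 + α) / 2) • QuantumInfoGeom.exponentialConnection n +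
        ((1 - α) / 2) • QuantumInfoGeom.mixtureConnection n : QuantumInfoGeom.Connection n) =
        QuantumInfoGeom.mixedConnection n ((1 - α) / 2) := by
      rw [QuantumInfoGeom.mixedConnection, add_comm, show 1 - (1 - α) / 2 = (1 + α) / 2 by ring]
    have h0 : (1 - α) / 2 ≠ 0 := (half_pos (sub_pos.2 hα.2)).ne'
    have h1 : (1 - α) / 2 ≠ 1 := fun h => by linarith [hα.1]
    rw [e]
    exact ⟨QuantumInfoGeom.mixedConnection_not_isFlat hn h0 h1,
      QuantumInfoGeom.mixedConnection_not_sameOn hn h0 h1⟩
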